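/- Let $(\Omega,\mathcal F,\mathbb P)$ be a probability space, $X\in L^2(\Omega)$ a real random variable and $(X_\ell)_{\ell\ge 0}\subset L^2(\Omega)$; put $X_{-1}=0$, $\Delta_\ell X = X_\ell-X_{\ell-1}$ and $V_\ell=\mathrm{Var}(\Delta_\ell X)$, and let $C_\ell>0$ be the cost of sampling $\Delta_\ell X$. Assume that there are constants $\alpha,\beta,\gamma,c_\alpha>0$ with $\min(\beta,\gamma)\le 2\alpha$ and constants $K>0$ and $0<c<c'$ such that for all $\ell\ge 0$ $$|\mathbb E[X-X_\ell]|\le c_\alpha e^{-\alpha\ell},\qquad V_\ell< K e^{-\beta\ell},\qquad c\,e^{\gamma\ell}< C_\ell< c' e^{\gamma\ell}.$$ Let $S_k=\sum_{\ell=0}^k\sqrt{V_\ell C_\ell}$, and for $\epsilon>0$ let $$L(\epsilon)=\max\Big(\Big\lceil \tfrac{\log(c_\alpha\epsilon^{-1})}{\alpha}\Big\rceil,1\Big),\qquad M_\ell(\epsilon)=\max\Big(\Big\lceil \epsilon^{-2}\sqrt{V_\ell/C_\ell}\;S_{L(\epsilon)}\Big\rceil,1\Big),\qquad \mathcal A_{ML}(\epsilon)=\sum_{\ell=0}^{L(\epsilon)}\sum_{i=1}^{M_\ell(\epsilon)}\frac{\Delta_\ell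 X^i}{M_\ell(\epsilon)},$$ where the random variables $\Delta_\ell X^i$ $(\ell\ge 0,\ i\ge 1)$ on $\Omega$ are mutually independent and each $\Delta_\ell X^i$ has the law of $\Delta_\ell X$. Write $Q_\ell=|\Delta_\ell X-\mathbb E[\Delta_\ell X]|^2/V_\ell$ when $V_\ell>0$, and consider the tail condition $$\lim_{\ell\to\infty}\mathbf 1_{\{V_\ell>0\}}\,\mathbb E\Big[Q_\ell\,\mathbf 1_{\{Q_\ell>\nu S_\ell^2 e^{(2\alpha-\gamma)\ell}\}}\Big]=0\qquad\text{for all }\nu>0.\tag{T}$$ Suppose that $V_0>0$ and that (i) if $\beta=\gamma$, then $\lim_{k\to\infty}S_k=\infty$ and (T) holds; (ii) if $\gamma>\beta$, then $\beta<2\alpha$, (T) holds, and there is $\upsilon\in[\beta,2\alpha)$ such that $S_k e^{(\upsilon-\gamma)k/2}>1$ for all sufficiently large $k$. Then $$\frac{\mathcal A_{ML}(\epsilon)-\mathbb E[X_{L(\epsilon)}]}{\sqrt{\mathrm{Var}(\mathcal A_{ML}(\epsilon))}}\;\xrightarrow{\ d\ }\;\mathcal N(0,1)\qquad\text{as }\epsilon\downarrow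 0 .$$ In particular, if $\beta>\gamma$, this convergence holds under the rate assumption and $V_0>0$ alone. -/

import Mathlib

open MeasureTheory ProbabilityTheory Filter Topology

noncomputable section

namespace MLMC

variable {Ω : Type*} [MeasurableSpace Ω]

/-- The level increment `Δ_ℓ X = X_ℓ - X_{ℓ-1}` for `ℓ = 0, 1, 2, …`, with `X_{-1} = 0`. -/
def increment (X : ℕ → Ω → ℝ) : ℕ → Ω → ℝ
  | 0 => X 0
  | ℓ + 1 => fun ω => X (ℓ + 1) ω - X ℓ ω

/-- `V_ℓ = Var(Δ_ℓ X)`. -/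
def levelVar (P : Measure Ω) (X : ℕ → Ω → ℝ) (ℓ : ℕ) : ℝ :=
  Var[increment X ℓ; P]

/-- `S_k = ∑_{ℓ=0}^k √(V_ℓ C_ℓ)`. -/
def levelSum (P : Measure Ω) (X : ℕ → Ω → ℝ) (C : ℕ → ℝ) (k : ℕ) : ℝ :=
  ∑ ℓ ∈ Finset.range (k + 1), √(levelVar P X ℓ * C ℓ)

/-- The rate assumption on the target `Xlim`, the levels `X_ℓ` and the costs
`C_ℓ = Cost(Δ_ℓ X)`. Costs are positive numbers, so the two-sided bound is on `C_ℓ` itself. -/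
structure RateAssumption (P : Measure Ω) (Xlim : Ω → ℝ) (X : ℕ → Ω → ℝ) (C : ℕ → ℝ)
    (α β γ cα : ℝ) : Prop where
  alpha_pos : 0 < α
  beta_pos : 0 < β
  gamma_pos : 0 < γ
  const_pos : 0 < cα
  min_le : min β γ ≤ 2 * α
  bias : ∀ ℓ : ℕ, |∫ ω, (Xlim ω - X ℓ ω) ∂P| ≤ cα * Real.exp (-α * ℓ)
  var_decay : ∃ K > 0, ∀ ℓ : ℕ, levelVar P X ℓ < K * Real.exp (-β * ℓ)
  cost_growth : ∃ c > 0, ∃ K > c, ∀ ℓ : ℕ,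
    c * Real.exp (γ * ℓ) < C ℓ ∧ C ℓ < K * Real.exp (γ * ℓ)

/-- `Y ℓ i`, `i = 0, 1, 2, …`, are the samples of `Δ_ℓ X`: all of them, over all levels and all
sample indices, are mutually independent, and those at level `ℓ` have the law of `Δ_ℓ X`. -/
structure IsSampling (P : Measure Ω) (X : ℕ → Ω → ℝ) (Y : ℕ → ℕ → Ω → ℝ) : Prop where
  indep : iIndepFun (fun p : ℕ × ℕ => Y p.1 p.2) P
  identDistrib : ∀ ℓ i : ℕ, IdentDistrib (Y ℓ i) (increment X ℓ) P P

/-- The number of levels `L(ε) = max(⌈log(c_α ε⁻¹) / α⌉, 1)`. -/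
def numLevels (α cα ε : ℝ) : ℕ :=
  max ⌈Real.log (cα * ε⁻¹) / α⌉₊ 1

/-- The number of samples
`M_ℓ(ε) = max(⌈ε⁻² √(V_ℓ / C_ℓ) ∑_{j=0}^{L(ε)} √(C_j V_j)⌉, 1)` on level `ℓ`. -/
def numSamples (P : Measure Ω) (X : ℕ → Ω → ℝ) (C : ℕ → ℝ) (α cα ε : ℝ) (ℓ : ℕ) : ℕ :=
  max ⌈(ε ^ 2)⁻¹ * √(levelVar P X ℓ / C ℓ) * levelSum P X C (numLevels α cα ε)⌉₊ 1

/-- The multilevel Monte Carlo estimator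
`A_ML(ε) = ∑_{ℓ=0}^{L(ε)} ∑_{i=1}^{M_ℓ(ε)} Δ_ℓ X^i / M_ℓ(ε)`. -/
def estimator (P : Measure Ω) (X : ℕ → Ω → ℝ) (C : ℕ → ℝ) (Y : ℕ → ℕ → Ω → ℝ) (α cα ε : ℝ) :
    Ω → ℝ :=
  fun ω => ∑ ℓ ∈ Finset.range (numLevels α cα ε + 1),
    ∑ i ∈ Finset.range (numSamples P X C α cα ε ℓ), Y ℓ i ω / numSamples P X C α cα ε ℓ

/-- The normalized estimator `(A_ML(ε) - E[X_{L(ε)}]) / √Var(A_ML(ε))`. -/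
def normalizedEstimator (P : Measure Ω) (X : ℕ → Ω → ℝ) (C : ℕ → ℝ) (Y : ℕ → ℕ → Ω → ℝ)
    (α cα ε : ℝ) : Ω → ℝ :=
  fun ω => (estimator P X C Y α cα ε ω - ∫ ω', X (numLevels α cα ε) ω' ∂P) /
    √Var[estimator P X C Y α cα ε; P]

/-- The squared normalized fluctuation `|Δ_ℓ X - E[Δ_ℓ X]|² / V_ℓ`. -/
def normSq (P : Measure Ω) (X : ℕ → Ω → ℝ) (ℓ : ℕ) (ω : Ω) : ℝ :=
  |increment X ℓ ω - ∫ ω', increment X ℓ ω' ∂P| ^ 2 / levelVar P X ℓ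

open Classical in
/-- The tail condition: for every `ν > 0`,
`1_{V_ℓ > 0} E[Q_ℓ 1_{Q_ℓ > ν S_ℓ² exp((2α-γ)ℓ)}] → 0` as `ℓ → ∞`, where
`Q_ℓ = |Δ_ℓ X - E[Δ_ℓ X]|² / V_ℓ`. -/
def TailCondition (P : Measure Ω) (X : ℕ → Ω → ℝ) (C : ℕ → ℝ) (α γ : ℝ) : Prop :=
  ∀ ν : ℝ, 0 < ν → Tendsto
    (fun ℓ : ℕ => if 0 < levelVar P X ℓ then
      ∫ ω, (if ν * levelSum P X C ℓ ^ 2 * Real.exp ((2 * α - γ) * ℓ) < normSq P X ℓ ω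
        then normSq P X ℓ ω else 0) ∂P
      else 0)
    atTop (𝓝 0)

end MLMC

end

/-! The normalized estimator is a sum of independent centered samples with total variance one, so
Lindeberg's theorem (`tendstoInDistribution_sum_of_lindeberg`, proved by characteristic functions)
applies. Write `w_ℓ = √(V_ℓ C_ℓ)`, `L = L(ε)` and `σ² = ∑ V_ℓ / M_ℓ`. Adding up the samples of each
level, the Lindeberg sum is `∑ V_ℓ / (M_ℓ σ²) · E[Q_ℓ 1_{Q_ℓ > δ² σ² M_ℓ² / V_ℓ}]`.

The key estimate is `σ² ≥ κ ε²` for small `ε`. Without rounding, `V_ℓ / M_ℓ` would be `ε² w_ℓ /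
S_L`, with sum `ε²`. Rounding up is harmless when `ε² ∑ C_ℓ / S_L²`, of order at most `e^{(γ-2α)L} /
S_L²`, tends to zero; the growth hypotheses on `S_k` ensure this if `β ≤ γ`. If `γ < β`, then `S_k`
is bounded and level `0` alone suffices.

Given this, the weights are at most `w_ℓ / (κ S_L)`, and the thresholds are at least a constant
times `ε⁻² S_L² / C_ℓ`, hence a constant times `S_ℓ² e^{(2α-γ)ℓ}`, the scale of the tail condition.
In `tendsto_lindeberg_sum` finitely many coarse levels vanish because each `Q_ℓ` is integrable and
its threshold diverges. The fine levels are negligible by the tail condition, or by summability of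
`w_ℓ` if `γ < β`. -/

section TaylorBounds

/-! ### Elementary inequalities for exponentials and products. -/

/-- Second-order Taylor bound for `exp (ix)` with a quadratic majorant and a cubic one. -/
lemma Complex.norm_exp_mul_I_sub_taylor_two_le (x : ℝ) :
    ‖Complex.exp (x * Complex.I) - (1 + x * Complex.I - x ^ 2 / 2)‖ ≤ 4 * x ^ 2 * min 1 |x| := by
  rcases le_or_gt |x| 1 with h | h
  · have hx : ‖(x * Complex.I : ℂ)‖ ≤ 1 := by simpa using h
    have := Complex.exp_bound hx (n := 3) (by norm_num)
    have e : (∑ m ∈ Finset.range 3, (x * Complex.I : ℂ) ^ m / (m.factorial : ℂ))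
        = 1 + x * Complex.I - x ^ 2 / 2 := by
      simp [Finset.sum_range_succ, mul_pow, Nat.factorial]
      ring
    rw [e] at this
    refine this.trans ?_
    rw [min_eq_right h]
    have e2 : ‖(x * Complex.I : ℂ)‖ = |x| := by simp
    rw [e2]
    have h3 : |x| ^ 3 = x ^ 2 * |x| := by rw [← sq_abs x]; ring
    have : (0 : ℝ) ≤ x ^ 2 * |x| := by positivity
    norm_num [Nat.factorial]
    rw [h3]
    linarith
  -- For `|x| > 1` the trivial bound `2 + |x| + x ^ 2 / 2` is already below `4 * x ^ 2`.
  · rw [min_eq_left h.le]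
    have h1 : ‖Complex.exp (x * Complex.I)‖ = 1 := Complex.norm_exp_ofReal_mul_I x
    have h2 : ‖(1 + x * Complex.I - x ^ 2 / 2 : ℂ)‖ ≤ 1 + |x| + x ^ 2 / 2 := by
      refine (norm_sub_le _ _).trans (add_le_add ((norm_add_le _ _).trans ?_) ?_) <;> simp
    refine (norm_sub_le _ _).trans ?_
    rw [h1]
    have := sq_abs x
    nlinarith

lemma Real.abs_exp_neg_sub_one_sub_le {a : ℝ} (ha : 0 ≤ a) : |Real.exp (-a) - (1 - a)| ≤ a ^ 2 := by
  rcases le_or_gt a 1 with h | h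
  · have := Real.abs_exp_sub_one_sub_id_le (x := -a) (by rw [abs_neg, abs_of_nonneg ha]; exact h)
    rw [neg_sq, sub_neg_eq_add] at this
    rwa [show Real.exp (-a) - (1 - a) = Real.exp (-a) - 1 + a by ring]
  · have h1 : Real.exp (-a) ≤ 1 := Real.exp_le_one_iff.2 (by linarith)
    have h2 := Real.add_one_le_exp (-a)
    rw [abs_of_nonneg (by linarith)]
    nlinarith

/-- Factors are exchanged one at a time; the untouched ones have norm at most one. -/
lemma norm_prod_sub_prod_le_sum {κ : Type*} (s : Finset κ) (f g : κ → ℂ)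
    (hf : ∀ j ∈ s, ‖f j‖ ≤ 1) (hg : ∀ j ∈ s, ‖g j‖ ≤ 1) :
    ‖∏ j ∈ s, f j - ∏ j ∈ s, g j‖ ≤ ∑ j ∈ s, ‖f j - g j‖ := by
  classical
  induction s using Finset.induction_on with
  | empty => simp
  | insert a s ha ih =>
    rw [Finset.prod_insert ha, Finset.prod_insert ha, Finset.sum_insert ha]
    have e : f a * ∏ j ∈ s, f j - g a * ∏ j ∈ s, g j
        = (f a - g a) * ∏ j ∈ s, f j + g a * (∏ j ∈ s, f j - ∏ j ∈ s, g j) := by ring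
    have h1 : ‖∏ j ∈ s, f j‖ ≤ 1 := by
      rw [norm_prod]
      exact Finset.prod_le_one (fun _ _ => norm_nonneg _)
        fun j hj => hf j (Finset.mem_insert_of_mem hj)
    rw [e]
    refine (norm_add_le _ _).trans (add_le_add ?_ ?_)
    · rw [norm_mul]
      exact mul_le_of_le_one_right (norm_nonneg _) h1
    · rw [norm_mul]
      refine (mul_le_of_le_one_left (norm_nonneg _) (hg a (Finset.mem_insert_self _ _))).trans ?_
      exact ih (fun j hj => hf j (Finset.mem_insert_of_mem hj))
        (fun j hj => hg j (Finset.mem_insert_of_mem hj))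

end TaylorBounds

/-! ### Truncated expectations. -/

section UpperTail

variable {Ω : Type*} [MeasurableSpace Ω] {P : Measure Ω}

/-- The truncated expectation `E[f 1_{f > a}]`. -/
noncomputable def upperTail (P : Measure Ω) (f : Ω → ℝ) (a : ℝ) : ℝ :=
  ∫ ω, (if a < f ω then f ω else 0) ∂P

lemma aestronglyMeasurable_ite_lt {f : Ω → ℝ} (hf : AEStronglyMeasurable f P) (a : ℝ) :
    AEStronglyMeasurable (fun ω => if a < f ω then f ω else 0) P := by
  have : Measurable (fun x : ℝ => if a < x then x else 0) :=
    Measurable.ite measurableSet_Ioi measurable_id measurable_const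
  exact (this.comp_aemeasurable hf.aemeasurable).aestronglyMeasurable

lemma integrable_ite_lt {f : Ω → ℝ} (hf : Integrable f P) (a : ℝ) :
    Integrable (fun ω => if a < f ω then f ω else 0) P := by
  refine hf.mono (aestronglyMeasurable_ite_lt hf.1 a) (ae_of_all _ fun ω => ?_)
  split_ifs <;> simp

lemma upperTail_nonneg {f : Ω → ℝ} (hf : ∀ ω, 0 ≤ f ω) (a : ℝ) : 0 ≤ upperTail P f a := by
  refine integral_nonneg fun ω => ?_
  dsimp only
  split_ifs
  exacts [hf ω, le_rfl]

lemma upperTail_le_integral {f : Ω → ℝ} (hf : ∀ ω, 0 ≤ f ω) (hi : Integrable f P) (a : ℝ) :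
    upperTail P f a ≤ ∫ ω, f ω ∂P := by
  refine integral_mono (integrable_ite_lt hi a) hi fun ω => ?_
  dsimp only
  split_ifs
  exacts [le_rfl, hf ω]

lemma upperTail_antitone {f : Ω → ℝ} (hf : ∀ ω, 0 ≤ f ω) (hi : Integrable f P) :
    Antitone (upperTail P f) := by
  intro a b hab
  refine integral_mono (integrable_ite_lt hi b) (integrable_ite_lt hi a) fun ω => ?_
  dsimp only
  split_ifs with h1 h2
  · exact le_rfl
  · exact absurd (hab.trans_lt h1) h2
  · exact hf ω
  · exact le_rfl

lemma tendsto_upperTail_atTop {f : Ω → ℝ} (hi : Integrable f P) :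
    Tendsto (upperTail P f) atTop (𝓝 0) := by
  have : Tendsto (upperTail P f) atTop (𝓝 (∫ _, (0 : ℝ) ∂P)) := by
    refine tendsto_integral_filter_of_dominated_convergence (fun ω => ‖f ω‖)
      (Eventually.of_forall fun a => aestronglyMeasurable_ite_lt hi.1 a)
      (Eventually.of_forall fun a => ae_of_all _ fun ω => ?_) hi.norm (ae_of_all _ fun ω => ?_)
    · split_ifs <;> simp
    · refine tendsto_const_nhds.congr' ?_
      filter_upwards [eventually_ge_atTop (f ω)] with a ha
      rw [if_neg (not_lt.2 ha)]
  simpa using this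

lemma upperTail_const_mul (f : Ω → ℝ) {c : ℝ} (hc : 0 < c) (a : ℝ) :
    upperTail P (fun ω => c * f ω) (c * a) = c * upperTail P f a := by
  unfold upperTail
  rw [← integral_const_mul]
  congr 1 with ω
  by_cases h : a < f ω
  · rw [if_pos h, if_pos ((mul_lt_mul_iff_right₀ hc).2 h)]
  · rw [if_neg h, if_neg (by rw [mul_lt_mul_iff_right₀ hc]; exact h), mul_zero]

lemma ProbabilityTheory.IdentDistrib.upperTail_eq {Ω' : Type*} [MeasurableSpace Ω']
    {P' : Measure Ω'} {f : Ω → ℝ} {g : Ω' → ℝ} (h : IdentDistrib f g P P') (a : ℝ) :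
    upperTail P f a = upperTail P' g a := by
  have : Measurable (fun x : ℝ => if a < x then x else 0) :=
    Measurable.ite measurableSet_Ioi measurable_id measurable_const
  exact (h.comp this).integral_eq

end UpperTail

/-! ### Lindeberg's central limit theorem. -/

section Lindeberg

variable {Ω : Type*} [MeasurableSpace Ω] {P : Measure Ω} [IsProbabilityMeasure P]

/-- Comparison of the characteristic function of a centered square-integrable variable with the
Gaussian one of the same variance. -/
lemma norm_charFun_map_sub_exp_le {ξ : Ω → ℝ} (hξ : MemLp ξ 2 P) (h0 : ∫ ω, ξ ω ∂P = 0)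
    {δ : ℝ} (hδ : 0 < δ) (t : ℝ) :
    ‖charFun (P.map ξ) t - Complex.exp (-((∫ ω, ξ ω ^ 2 ∂P) * t ^ 2 / 2 : ℝ))‖
      ≤ 4 * t ^ 2 * upperTail P (fun ω => ξ ω ^ 2) (δ ^ 2) + 4 * |t| ^ 3 * δ * ∫ ω, ξ ω ^ 2 ∂P
        + t ^ 4 * (∫ ω, ξ ω ^ 2 ∂P) ^ 2 := by
  set s := ∫ ω, ξ ω ^ 2 ∂P with hs
  have hi1 : Integrable ξ P := hξ.integrable (by norm_num)
  have hi2 : Integrable (fun ω => ξ ω ^ 2) P := hξ.integrable_sq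
  have hs0 : 0 ≤ s := integral_nonneg fun ω => sq_nonneg _
  have hint : Integrable (fun ω => Complex.exp ((t * ξ ω : ℝ) * Complex.I)) P := by
    refine Integrable.of_bound (C := 1) ?_ (ae_of_all _ fun ω => ?_)
    · have : Continuous fun x : ℝ => Complex.exp ((t * x : ℝ) * Complex.I) := by fun_prop
      exact this.comp_aestronglyMeasurable hξ.1
    · rw [Complex.norm_exp_ofReal_mul_I]
  have hc1 : charFun (P.map ξ) t = ∫ ω, Complex.exp ((t * ξ ω : ℝ) * Complex.I) ∂P := by
    rw [charFun_apply_real, integral_map hξ.1.aemeasurable (by fun_prop)]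
    simp
  have hT : Integrable (fun ω => (1 + ((t * ξ ω : ℝ) : ℂ) * Complex.I
      - ((t * ξ ω : ℝ) : ℂ) ^ 2 / 2)) P := by
    refine ((integrable_const _).add ((hi1.const_mul t).ofReal.mul_const _)).sub ?_
    have := ((hi2.const_mul (t ^ 2)).ofReal (𝕜 := ℂ)).div_const 2
    refine this.congr (ae_of_all _ fun ω => ?_)
    simp [mul_pow]
  have hc2 : ∫ ω, (1 + ((t * ξ ω : ℝ) : ℂ) * Complex.I - ((t * ξ ω : ℝ) : ℂ) ^ 2 / 2) ∂P
      = ((1 - s * t ^ 2 / 2 : ℝ) : ℂ) := by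
    have e : ∀ ω, (1 + ((t * ξ ω : ℝ) : ℂ) * Complex.I - ((t * ξ ω : ℝ) : ℂ) ^ 2 / 2)
        = ((1 - t ^ 2 / 2 * ξ ω ^ 2 : ℝ) : ℂ) + ((t * ξ ω : ℝ) : ℂ) * Complex.I := fun ω => by
      push_cast; ring
    simp_rw [e]
    rw [integral_add, integral_mul_const, integral_complex_ofReal, integral_complex_ofReal,
      integral_const_mul, h0, integral_sub, integral_const_mul, ← hs]
    · simp; ring
    · exact integrable_const _
    · exact hi2.const_mul _
    · exact ((integrable_const _).sub (hi2.const_mul _)).ofReal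
    · exact ((hi1.const_mul t).ofReal).mul_const _
  have hm : ‖charFun (P.map ξ) t - ((1 - s * t ^ 2 / 2 : ℝ) : ℂ)‖
      ≤ 4 * t ^ 2 * upperTail P (fun ω => ξ ω ^ 2) (δ ^ 2) + 4 * |t| ^ 3 * δ * s := by
    rw [hc1, ← hc2, ← integral_sub hint hT]
    -- The quadratic majorant is used where `|ξ| > δ`, the cubic one where `|ξ| ≤ δ`.
    refine (norm_integral_le_of_norm_le (g := fun ω => 4 * t ^ 2 *
      (if δ ^ 2 < ξ ω ^ 2 then ξ ω ^ 2 else 0) + 4 * |t| ^ 3 * δ * ξ ω ^ 2) ?_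
      (ae_of_all _ fun ω => ?_)).trans (le_of_eq ?_)
    · exact ((integrable_ite_lt hi2 _).const_mul _).add (hi2.const_mul _)
    · refine (Complex.norm_exp_mul_I_sub_taylor_two_le _).trans ?_
      split_ifs with h
      · have h1 : min 1 |t * ξ ω| ≤ 1 := min_le_left _ _
        have h2 : 0 ≤ 4 * |t| ^ 3 * δ * ξ ω ^ 2 := by positivity
        calc 4 * (t * ξ ω) ^ 2 * min 1 |t * ξ ω| ≤ 4 * (t * ξ ω) ^ 2 * 1 := by gcongr
          _ = 4 * t ^ 2 * ξ ω ^ 2 := by ring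
          _ ≤ _ := by linarith
      · have h1 : min 1 |t * ξ ω| ≤ |t * ξ ω| := min_le_right _ _
        have h2 : |ξ ω| ≤ δ := abs_le_of_sq_le_sq (not_lt.1 h) hδ.le
        calc 4 * (t * ξ ω) ^ 2 * min 1 |t * ξ ω| ≤ 4 * (t * ξ ω) ^ 2 * |t * ξ ω| := by gcongr
          _ = 4 * |t| ^ 3 * |ξ ω| * ξ ω ^ 2 := by
            rw [abs_mul, mul_pow, ← sq_abs t]; ring
          _ ≤ 4 * |t| ^ 3 * δ * ξ ω ^ 2 := by gcongr
          _ = _ := by ring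
    · rw [integral_add ((integrable_ite_lt hi2 _).const_mul _) (hi2.const_mul _),
        integral_const_mul, integral_const_mul]
      rfl
  have he : ‖((1 - s * t ^ 2 / 2 : ℝ) : ℂ) - Complex.exp (-(s * t ^ 2 / 2 : ℝ))‖
      ≤ t ^ 4 * s ^ 2 := by
    rw [← Complex.ofReal_neg, ← Complex.ofReal_exp, ← Complex.ofReal_sub, Complex.norm_real,
      norm_sub_rev, Real.norm_eq_abs]
    refine (Real.abs_exp_neg_sub_one_sub_le (by positivity)).trans ?_
    have : 0 ≤ t ^ 4 * s ^ 2 := by positivity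
    nlinarith
  calc _ ≤ _ := norm_sub_le_norm_sub_add_norm_sub _ ((1 - s * t ^ 2 / 2 : ℝ) : ℂ) _
    _ ≤ _ := add_le_add hm he

/-- Quantitative form of Lindeberg's theorem, on the level of characteristic functions. -/
lemma norm_charFun_map_sum_sub_exp_le {κ : Type*} {ξ : κ → Ω → ℝ} (s : Finset κ)
    (hξ : ∀ j, MemLp (ξ j) 2 P) (h0 : ∀ j, ∫ ω, ξ j ω ∂P = 0) (hind : iIndepFun ξ P)
    (hvar : ∑ j ∈ s, ∫ ω, ξ j ω ^ 2 ∂P = 1) {δ : ℝ} (hδ : 0 < δ) (t : ℝ) :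
    ‖charFun (P.map (fun ω => ∑ j ∈ s, ξ j ω)) t - Complex.exp (-(t ^ 2 / 2 : ℝ))‖
      ≤ (4 * t ^ 2 + t ^ 4) * ∑ j ∈ s, upperTail P (fun ω => ξ j ω ^ 2) (δ ^ 2)
        + 4 * |t| ^ 3 * δ + t ^ 4 * δ ^ 2 := by
  have hm : ∀ j, AEMeasurable (ξ j) P := fun j => (hξ j).1.aemeasurable
  have hs0 : ∀ j, 0 ≤ ∫ ω, ξ j ω ^ 2 ∂P := fun j => integral_nonneg fun ω => sq_nonneg _
  have hi2 : ∀ j, Integrable (fun ω => ξ j ω ^ 2) P := fun j => (hξ j).integrable_sq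
  have hle1 : ∀ j ∈ s, ∫ ω, ξ j ω ^ 2 ∂P ≤ 1 := fun j hj =>
    hvar ▸ Finset.single_le_sum (f := fun j => ∫ ω, ξ j ω ^ 2 ∂P) (fun j _ => hs0 j) hj
  -- Splitting at `δ` gives `s_j ≤ tail + δ²` for the variance `s_j`; multiplying by `s_j ≤ 1`
  -- controls the squared variances, so no separate smallness of the largest variance is needed.
  have hsq : ∀ j ∈ s, (∫ ω, ξ j ω ^ 2 ∂P) ^ 2
      ≤ upperTail P (fun ω => ξ j ω ^ 2) (δ ^ 2) + δ ^ 2 * ∫ ω, ξ j ω ^ 2 ∂P := by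
    intro j hj
    have hu : 0 ≤ upperTail P (fun ω => ξ j ω ^ 2) (δ ^ 2) :=
      upperTail_nonneg (fun _ => sq_nonneg _) _
    have : ∫ ω, ξ j ω ^ 2 ∂P ≤ upperTail P (fun ω => ξ j ω ^ 2) (δ ^ 2) + δ ^ 2 := by
      have hI : Integrable (fun ω => (if δ ^ 2 < ξ j ω ^ 2 then ξ j ω ^ 2 else 0) + δ ^ 2) P :=
        (integrable_ite_lt (hi2 j) _).add (integrable_const _)
      refine (integral_mono (hi2 j) hI fun ω => ?_).trans (le_of_eq ?_)
      · dsimp only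
        split_ifs with h
        · nlinarith
        · linarith [not_lt.1 h]
      · rw [integral_add (integrable_ite_lt (hi2 j) _) (integrable_const _)]
        simp [upperTail]
    nlinarith [hs0 j, hle1 j hj]
  have hprod : Complex.exp (-(t ^ 2 / 2 : ℝ))
      = ∏ j ∈ s, Complex.exp (-((∫ ω, ξ j ω ^ 2 ∂P) * t ^ 2 / 2 : ℝ)) := by
    rw [← Complex.exp_sum, Finset.sum_neg_distrib, ← Complex.ofReal_sum]
    congr 3
    simp_rw [mul_div_assoc]
    rw [← Finset.sum_mul, hvar, one_mul]
  rw [(hind.restrict _).charFun_map_fun_finsetSum_eq_prod (fun j _ => hm j), hprod,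
    Finset.prod_apply]
  refine (norm_prod_sub_prod_le_sum s _ _ (fun j _ => ?_) (fun j _ => ?_)).trans ?_
  · have := Measure.isProbabilityMeasure_map (hm j)
    exact norm_charFun_le_one _
  · rw [← Complex.ofReal_neg, ← Complex.ofReal_exp, Complex.norm_real, Real.norm_eq_abs,
      abs_of_pos (Real.exp_pos _), Real.exp_le_one_iff]
    have := hs0 j
    have : 0 ≤ (∫ ω, ξ j ω ^ 2 ∂P) * t ^ 2 / 2 := by positivity
    linarith
  · calc _ ≤ ∑ j ∈ s, ((4 * t ^ 2 + t ^ 4) * upperTail P (fun ω => ξ j ω ^ 2) (δ ^ 2)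
            + (4 * |t| ^ 3 * δ + t ^ 4 * δ ^ 2) * ∫ ω, ξ j ω ^ 2 ∂P) := by
          refine Finset.sum_le_sum fun j hj =>
            (norm_charFun_map_sub_exp_le (hξ j) (h0 j) hδ t).trans ?_
          have : 0 ≤ t ^ 4 := by positivity
          nlinarith [mul_le_mul_of_nonneg_left (hsq j hj) this]
      _ = _ := by
          rw [Finset.sum_add_distrib, ← Finset.mul_sum, ← Finset.mul_sum, hvar]
          ring

/-- **Lindeberg's central limit theorem** for a family of finite sums of independent centered
variables, along a countably generated filter. -/
theorem tendstoInDistribution_sum_of_lindeberg {ι κ : Type*} {l : Filter ι}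
    [l.IsCountablyGenerated] (s : ι → Finset κ) (ξ : ι → κ → Ω → ℝ)
    (hξ : ∀ n j, MemLp (ξ n j) 2 P) (h0 : ∀ n j, ∫ ω, ξ n j ω ∂P = 0)
    (hind : ∀ n, iIndepFun (ξ n) P)
    (hvar : ∀ᶠ n in l, ∑ j ∈ s n, ∫ ω, ξ n j ω ^ 2 ∂P = 1)
    (hlind : ∀ δ : ℝ, 0 < δ →
      Tendsto (fun n => ∑ j ∈ s n, upperTail P (fun ω => ξ n j ω ^ 2) (δ ^ 2)) l (𝓝 0)) :
    TendstoInDistribution (fun n ω => ∑ j ∈ s n, ξ n j ω) l (id : ℝ → ℝ)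
      (fun _ => P) (gaussianReal 0 1) where
  forall_aemeasurable n := Finset.aemeasurable_fun_sum _ fun j _ => (hξ n j).1.aemeasurable
  tendsto := by
    have key : ∀ t : ℝ, Tendsto (fun n => charFun (P.map (fun ω => ∑ j ∈ s n, ξ n j ω)) t) l
        (𝓝 (Complex.exp (-(t ^ 2 / 2 : ℝ)))) := by
      intro t
      rw [Metric.tendsto_nhds]
      intro ε hε
      obtain ⟨δ, hδ, hδε⟩ : ∃ δ : ℝ, 0 < δ ∧ 4 * |t| ^ 3 * δ + t ^ 4 * δ ^ 2 < ε / 2 := by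
        have hc : Tendsto (fun δ : ℝ => 4 * |t| ^ 3 * δ + t ^ 4 * δ ^ 2) (𝓝[>] 0) (𝓝 0) := by
          have : Continuous fun δ : ℝ => 4 * |t| ^ 3 * δ + t ^ 4 * δ ^ 2 := by fun_prop
          simpa using (this.tendsto 0).mono_left nhdsWithin_le_nhds
        obtain ⟨δ, h1, h2⟩ := ((hc.eventually (gt_mem_nhds (half_pos hε))).and
          self_mem_nhdsWithin).exists
        exact ⟨δ, h2, h1⟩
      have hL : Tendsto (fun n => (4 * t ^ 2 + t ^ 4) *
          ∑ j ∈ s n, upperTail P (fun ω => ξ n j ω ^ 2) (δ ^ 2)) l (𝓝 0) := by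
        simpa using (hlind δ hδ).const_mul (4 * t ^ 2 + t ^ 4)
      filter_upwards [hvar, hL.eventually (gt_mem_nhds (half_pos hε))] with n hn1 hn2
      rw [dist_eq_norm]
      have := norm_charFun_map_sum_sub_exp_le (s n) (hξ n) (h0 n) (hind n) hn1 hδ t
      linarith
    -- Countable generation of `l` reduces the claim to sequences, for which Lévy's continuity
    -- theorem applies.
    refine tendsto_of_seq_tendsto fun u hu => ?_
    refine ProbabilityMeasure.tendsto_iff_tendsto_charFun.2 fun t => ?_
    have := (key t).comp hu
    have e : charFun (Measure.map (id : ℝ → ℝ) (gaussianReal 0 1)) t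
        = Complex.exp (-(t ^ 2 / 2 : ℝ)) := by
      simp [charFun_gaussianReal]
    exact (congrArg 𝓝 e).symm ▸ this

end Lindeberg

/-! ### Effect of rounding the sample sizes. -/

section SampleSize

variable {V C S ε : ℝ}

lemma sqrt_div_eq_sqrt_mul_div (V : ℝ) (hC : 0 < C) : √(V / C) = √(V * C) / C := by
  rw [show V / C = V * C / C ^ 2 by field_simp, Real.sqrt_div' _ (sq_nonneg C), Real.sqrt_sq hC.le]

/-- The unrounded sample size gives equality, and rounding up only lowers `V / M`. -/
lemma div_max_ceil_le (hV : 0 ≤ V) (hC : 0 < C) (hS : 0 < S) (hε : 0 < ε) :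
    V / (max ⌈(ε ^ 2)⁻¹ * √(V / C) * S⌉₊ 1 : ℕ) ≤ ε ^ 2 * √(V * C) / S := by
  set M := max ⌈(ε ^ 2)⁻¹ * √(V / C) * S⌉₊ 1 with hM
  have hM1 : 1 ≤ M := le_max_right _ _
  have hMx : (ε ^ 2)⁻¹ * √(V / C) * S ≤ M :=
    (Nat.le_ceil _).trans (by exact_mod_cast le_max_left _ _)
  have hM0 : (0 : ℝ) < M := by exact_mod_cast hM1
  rw [div_le_iff₀ hM0]
  have hw : √(V * C) ^ 2 = V * C := Real.sq_sqrt (by positivity)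
  have : V = ε ^ 2 * √(V * C) / S * ((ε ^ 2)⁻¹ * √(V / C) * S) := by
    rw [sqrt_div_eq_sqrt_mul_div V hC]
    field_simp
    linarith
  calc V = ε ^ 2 * √(V * C) / S * ((ε ^ 2)⁻¹ * √(V / C) * S) := this
    _ ≤ ε ^ 2 * √(V * C) / S * M := by gcongr

/-- Let `x` be the unrounded size. If `x ≥ 1`, then `M ≤ 2x`, which costs the factor `1/2`. If `x <
1`, then `√(V * C) < ε ^ 2 * C / S` and the left side is negative. The subtracted term makes one
formula serve both cases and sums well over levels. -/
lemma le_div_max_ceil (hV : 0 ≤ V) (hC : 0 < C) (hS : 0 < S) (hε : 0 < ε) :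
    ε ^ 2 / (2 * S) * (√(V * C) - ε ^ 2 * C / S)
      ≤ V / (max ⌈(ε ^ 2)⁻¹ * √(V / C) * S⌉₊ 1 : ℕ) := by
  set x := (ε ^ 2)⁻¹ * √(V / C) * S with hx
  have hx' : x = √(V * C) * S / (ε ^ 2 * C) := by
    rw [hx, sqrt_div_eq_sqrt_mul_div V hC]; field_simp
  have hw : √(V * C) ^ 2 = V * C := Real.sq_sqrt (by positivity)
  have hw0 : 0 ≤ √(V * C) := Real.sqrt_nonneg _
  rcases le_or_gt 1 x with h | h
  · have hceil : 1 ≤ ⌈x⌉₊ := Nat.one_le_ceil_iff.2 (by linarith)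
    rw [max_eq_left hceil]
    have hM0 : (0 : ℝ) < ⌈x⌉₊ := by exact_mod_cast hceil
    have hM2 : (⌈x⌉₊ : ℝ) ≤ 2 * x := by linarith [Nat.ceil_lt_add_one (a := x) (by linarith)]
    rw [le_div_iff₀ hM0]
    have h1 : ε ^ 2 / (2 * S) * (√(V * C) - ε ^ 2 * C / S) ≤ ε ^ 2 / (2 * S) * √(V * C) := by
      gcongr
      have : 0 ≤ ε ^ 2 * C / S := by positivity
      linarith
    calc _ ≤ ε ^ 2 / (2 * S) * √(V * C) * ⌈x⌉₊ := by gcongr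
      _ ≤ ε ^ 2 / (2 * S) * √(V * C) * (2 * x) := by gcongr
      _ = V := by rw [hx']; field_simp; linarith
  · have : √(V * C) ≤ ε ^ 2 * C / S := by
      rw [hx', div_lt_one (by positivity)] at h
      rw [le_div_iff₀ hS]
      exact h.le
    refine le_trans (mul_nonpos_of_nonneg_of_nonpos (by positivity) (by linarith)) ?_
    positivity

/-- Lower bound for the Lindeberg threshold; `σ` plays the role of the estimator's variance, not of
its standard deviation. -/
lemma le_mul_sq_max_ceil_div {κ σ : ℝ} (hV : 0 < V) (hC : 0 < C) (hS : 0 < S) (hε : 0 < ε)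
    (hκ : 0 ≤ κ) (hσ : κ * ε ^ 2 ≤ σ) :
    κ * (ε ^ 2)⁻¹ * S ^ 2 / C ≤ σ * (max ⌈(ε ^ 2)⁻¹ * √(V / C) * S⌉₊ 1 : ℕ) ^ 2 / V := by
  set M := max ⌈(ε ^ 2)⁻¹ * √(V / C) * S⌉₊ 1 with hM
  have hMx : (ε ^ 2)⁻¹ * √(V / C) * S ≤ M :=
    (Nat.le_ceil _).trans (by exact_mod_cast le_max_left _ _)
  have hw : √(V / C) ^ 2 = V / C := Real.sq_sqrt (by positivity)
  have hσ0 : 0 ≤ σ := le_trans (by positivity) hσ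
  calc κ * (ε ^ 2)⁻¹ * S ^ 2 / C
      = κ * ε ^ 2 * ((ε ^ 2)⁻¹ * √(V / C) * S) ^ 2 / V := by
        rw [mul_pow, mul_pow, hw]; field_simp
    _ ≤ σ * (M : ℝ) ^ 2 / V := by gcongr

end SampleSize

namespace MLMC

/-! ### Asymptotics of the number of levels. -/

section NumLevels

variable {α cα : ℝ}

lemma tendsto_log_const_mul_inv_div (hα : 0 < α) (hc : 0 < cα) :
    Tendsto (fun ε : ℝ => Real.log (cα * ε⁻¹) / α) (𝓝[>] 0) atTop :=
  (Real.tendsto_log_atTop.comp (tendsto_inv_nhdsGT_zero.const_mul_atTop hc)).atTop_div_const hα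

lemma tendsto_numLevels (hα : 0 < α) (hc : 0 < cα) :
    Tendsto (numLevels α cα) (𝓝[>] 0) atTop :=
  tendsto_atTop_mono (fun _ => le_max_left _ _)
    (tendsto_nat_ceil_atTop.comp (tendsto_log_const_mul_inv_div hα hc))

/-- The ceiling adds less than one to its argument, whence the factor `exp α`. This bound later
trades `ε⁻²` for `e^{2αℓ}`, `ℓ ≤ L(ε)`. -/
lemma eventually_mul_exp_numLevels_le (hα : 0 < α) (hc : 0 < cα) :
    ∀ᶠ ε : ℝ in 𝓝[>] 0, ε * Real.exp (α * numLevels α cα ε) ≤ cα * Real.exp α := by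
  filter_upwards [(tendsto_log_const_mul_inv_div hα hc).eventually_gt_atTop 0,
    self_mem_nhdsWithin] with ε h1 h2
  have h2 : 0 < ε := h2
  have hceil : 1 ≤ ⌈Real.log (cα * ε⁻¹) / α⌉₊ := Nat.one_le_ceil_iff.2 h1
  rw [numLevels, max_eq_left hceil]
  have h3 := (Nat.ceil_lt_add_one h1.le).le
  have h4 : α * (⌈Real.log (cα * ε⁻¹) / α⌉₊ : ℝ) ≤ Real.log (cα * ε⁻¹) + α := by
    calc _ ≤ α * (Real.log (cα * ε⁻¹) / α + 1) := by gcongr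
      _ = _ := by field_simp
  calc _ ≤ ε * Real.exp (Real.log (cα * ε⁻¹) + α) := by gcongr
    _ = cα * Real.exp α := by
      rw [Real.exp_add, Real.exp_log (by positivity)]
      field_simp

end NumLevels

/-! ### Growth of costs and level sums; lower bound for the variance. -/

section Levels

variable {Ω : Type*} [MeasurableSpace Ω] {P : Measure Ω} {Xlim : Ω → ℝ} {X : ℕ → Ω → ℝ}
  {C : ℕ → ℝ} {α β γ cα : ℝ}

lemma levelVar_nonneg (P : Measure Ω) (X : ℕ → Ω → ℝ) (ℓ : ℕ) : 0 ≤ levelVar P X ℓ :=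
  variance_nonneg _ _

lemma levelSum_mono (P : Measure Ω) (X : ℕ → Ω → ℝ) (C : ℕ → ℝ) : Monotone (levelSum P X C) := by
  intro a b hab
  exact Finset.sum_le_sum_of_subset_of_nonneg (Finset.range_mono (by omega))
    fun _ _ _ => Real.sqrt_nonneg _

lemma sqrt_le_levelSum (P : Measure Ω) (X : ℕ → Ω → ℝ) (C : ℕ → ℝ) {ℓ k : ℕ} (h : ℓ ≤ k) :
    √(levelVar P X ℓ * C ℓ) ≤ levelSum P X C k :=
  Finset.single_le_sum (f := fun ℓ => √(levelVar P X ℓ * C ℓ)) (fun _ _ => Real.sqrt_nonneg _)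
    (Finset.mem_range.2 (by omega))

lemma RateAssumption.cost_pos (h : RateAssumption P Xlim X C α β γ cα) (ℓ : ℕ) : 0 < C ℓ := by
  obtain ⟨c, hc, K, hK, hC⟩ := h.cost_growth
  exact lt_trans (by positivity) (hC ℓ).1

lemma levelSum_pos (hV0 : 0 < levelVar P X 0) (hC : 0 < C 0) (k : ℕ) : 0 < levelSum P X C k :=
  (Real.sqrt_pos.2 (mul_pos hV0 hC)).trans_le (sqrt_le_levelSum P X C (Nat.zero_le k))

/-- If the variances decay faster than the costs grow, the levels contribute summably. -/
lemma RateAssumption.summable_sqrt (h : RateAssumption P Xlim X C α β γ cα) (hβγ : γ < β) :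
    Summable fun ℓ => √(levelVar P X ℓ * C ℓ) := by
  obtain ⟨K, hK, hV⟩ := h.var_decay
  obtain ⟨c, hc, K', hK', hC⟩ := h.cost_growth
  have hK'0 : 0 < K' := hc.trans hK'
  have hs : Summable fun ℓ : ℕ => √(K * K') * Real.exp (-((β - γ) / 2)) ^ ℓ :=
    (summable_geometric_of_lt_one (Real.exp_pos _).le
      (Real.exp_lt_one_iff.2 (by linarith))).mul_left _
  refine Summable.of_nonneg_of_le (fun _ => Real.sqrt_nonneg _) (fun ℓ => ?_) hs
  calc √(levelVar P X ℓ * C ℓ)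
      ≤ √(K * Real.exp (-β * ℓ) * (K' * Real.exp (γ * ℓ))) := by
        refine Real.sqrt_le_sqrt ?_
        exact mul_le_mul (hV ℓ).le (hC ℓ).2.le (h.cost_pos ℓ).le (by positivity)
    _ = √((√(K * K') * Real.exp (-((β - γ) / 2)) ^ ℓ) ^ 2) := by
        congr 1
        rw [mul_pow, Real.sq_sqrt (by positivity), ← Real.exp_nat_mul, ← Real.exp_nat_mul,
          mul_mul_mul_comm, ← Real.exp_add]
        congr 2
        push_cast
        ring
    _ = _ := Real.sqrt_sq (by positivity)

/-- The total cost of one sample per level is dominated by the finest level. -/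
lemma RateAssumption.sum_cost_le (h : RateAssumption P Xlim X C α β γ cα) :
    ∃ A > 0, ∀ k : ℕ, ∑ ℓ ∈ Finset.range (k + 1), C ℓ ≤ A * Real.exp (γ * k) := by
  obtain ⟨c, hc, K, hK, hC⟩ := h.cost_growth
  have hK0 : 0 < K := hc.trans hK
  have hq : 1 < Real.exp γ := Real.one_lt_exp_iff.2 h.gamma_pos
  refine ⟨K * Real.exp γ / (Real.exp γ - 1), by
    have : 0 < Real.exp γ - 1 := by linarith
    positivity, fun k => ?_⟩
  calc ∑ ℓ ∈ Finset.range (k + 1), C ℓ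
      ≤ ∑ ℓ ∈ Finset.range (k + 1), K * Real.exp γ ^ ℓ := by
        refine Finset.sum_le_sum fun ℓ _ => ?_
        rw [← Real.exp_nat_mul, mul_comm (ℓ : ℝ)]
        exact (hC ℓ).2.le
    _ = K * ((Real.exp γ ^ (k + 1) - 1) / (Real.exp γ - 1)) := by
        rw [← Finset.mul_sum, geom_sum_eq hq.ne']
    _ ≤ K * (Real.exp γ ^ (k + 1) / (Real.exp γ - 1)) := by
        have : 0 < Real.exp γ - 1 := by linarith
        gcongr
        linarith
    _ = _ := by
        rw [pow_succ, ← Real.exp_nat_mul, mul_comm (k : ℝ)]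
        ring

/-- Under the growth hypotheses on `S_k`, `exp ((γ - 2α) k) = o(S_k²)`. -/
lemma tendsto_exp_div_levelSum_sq (hmin : min β γ ≤ 2 * α) (hβγ : β ≤ γ)
    (h_eq : β = γ → Tendsto (levelSum P X C) atTop atTop)
    (h_lt : β < γ → ∃ υ : ℝ, υ < 2 * α ∧
      ∀ᶠ k : ℕ in atTop, 1 < levelSum P X C k * Real.exp ((υ - γ) * k / 2)) :
    Tendsto (fun k : ℕ => Real.exp ((γ - 2 * α) * k) / levelSum P X C k ^ 2) atTop (𝓝 0) := by
  rcases hβγ.eq_or_lt with h | h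
  · have hS := h_eq h
    have hg : γ ≤ 2 * α := by rwa [h, min_self] at hmin
    have hinv : Tendsto (fun k => (levelSum P X C k ^ 2)⁻¹) atTop (𝓝 0) :=
      tendsto_inv_atTop_zero.comp ((tendsto_pow_atTop two_ne_zero).comp hS)
    refine squeeze_zero (fun k => by positivity) (fun k => ?_) hinv
    rw [div_eq_mul_inv]
    refine mul_le_of_le_one_left (by positivity) (Real.exp_le_one_iff.2 ?_)
    exact mul_nonpos_of_nonpos_of_nonneg (by linarith) (Nat.cast_nonneg _)
  · obtain ⟨υ, hυ, hS⟩ := h_lt h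
    have h0 : Tendsto (fun k : ℕ => Real.exp (-(2 * α - υ) * k)) atTop (𝓝 0) := by
      refine Real.tendsto_exp_atBot.comp ?_
      exact (tendsto_natCast_atTop_atTop).const_mul_atTop_of_neg (by linarith)
    refine squeeze_zero' (Eventually.of_forall fun k => by positivity) ?_ h0
    filter_upwards [hS] with k hk
    -- Squaring the growth hypothesis gives `S_k² ≥ e^{(γ-υ)k}`, so the quotient is at most
    -- `e^{-(2α-υ)k}`.
    have h1 : 1 ≤ levelSum P X C k ^ 2 * Real.exp ((υ - γ) * k) := by
      have e : levelSum P X C k ^ 2 * Real.exp ((υ - γ) * k)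
          = (levelSum P X C k * Real.exp ((υ - γ) * k / 2)) ^ 2 := by
        rw [mul_pow, ← Real.exp_nat_mul]
        congr 2
        push_cast
        ring
      rw [e]
      nlinarith
    have hS0 : 0 < levelSum P X C k ^ 2 := by
      by_contra hn
      have : levelSum P X C k ^ 2 = 0 := le_antisymm (not_lt.1 hn) (sq_nonneg _)
      rw [this] at h1
      linarith
    rw [div_le_iff₀ hS0]
    calc Real.exp ((γ - 2 * α) * k) = Real.exp ((γ - 2 * α) * k) * 1 := by ring
      _ ≤ Real.exp ((γ - 2 * α) * k) * (levelSum P X C k ^ 2 * Real.exp ((υ - γ) * k)) := by gcongr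
      _ = Real.exp (-(2 * α - υ) * k) * levelSum P X C k ^ 2 := by
        rw [mul_left_comm, ← Real.exp_add, mul_comm]
        ring_nf

/-- The variance `∑ V_ℓ / M_ℓ` of the multilevel estimator. -/
noncomputable def estimatorVar (P : Measure Ω) (X : ℕ → Ω → ℝ) (C : ℕ → ℝ) (α cα ε : ℝ) : ℝ :=
  ∑ ℓ ∈ Finset.range (numLevels α cα ε + 1), levelVar P X ℓ / numSamples P X C α cα ε ℓ

/-- The estimator has variance of the order `ε²` when the levels contribute summably. -/
lemma RateAssumption.le_estimatorVar_of_lt (h : RateAssumption P Xlim X C α β γ cα)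
    (hV0 : 0 < levelVar P X 0) (hβγ : γ < β) :
    ∃ κ > 0, ∀ᶠ ε : ℝ in 𝓝[>] 0, κ * ε ^ 2 ≤ estimatorVar P X C α cα ε := by
  have hs := h.summable_sqrt hβγ
  set w₀ := √(levelVar P X 0 * C 0) with hw₀
  set B := ∑' ℓ, √(levelVar P X ℓ * C ℓ) with hB
  have hw₀0 : 0 < w₀ := Real.sqrt_pos.2 (mul_pos hV0 (h.cost_pos 0))
  have hSB : ∀ k, levelSum P X C k ≤ B := fun k =>
    hs.sum_le_tsum _ fun _ _ => Real.sqrt_nonneg _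
  have hB0 : 0 < B := (levelSum_pos hV0 (h.cost_pos 0) 0).trans_le (hSB 0)
  have hsmall : ∀ᶠ ε : ℝ in 𝓝[>] 0, ε ^ 2 * C 0 / w₀ ≤ w₀ / 2 := by
    have hc : Continuous fun ε : ℝ => ε ^ 2 * C 0 / w₀ := by fun_prop
    have := (hc.tendsto 0).mono_left (nhdsWithin_le_nhds (s := Set.Ioi 0))
    simp only [ne_eq, OfNat.ofNat_ne_zero, not_false_eq_true, zero_pow, zero_mul, zero_div] at this
    exact (this.eventually (gt_mem_nhds (half_pos hw₀0))).mono fun _ => le_of_lt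
  -- Only level `0` is kept: `1/2` comes from `le_div_max_ceil`, another `1/2` from `hsmall`, and `S
  -- ≤ B`.
  refine ⟨w₀ / (4 * B), by positivity, ?_⟩
  filter_upwards [hsmall, self_mem_nhdsWithin] with ε h1 hε
  have hε : 0 < ε := hε
  set S := levelSum P X C (numLevels α cα ε) with hS
  have hS0 : 0 < S := levelSum_pos hV0 (h.cost_pos 0) _
  have hwS : w₀ ≤ S := sqrt_le_levelSum P X C (Nat.zero_le _)
  have hC0 := h.cost_pos 0
  calc w₀ / (4 * B) * ε ^ 2 ≤ w₀ / (4 * S) * ε ^ 2 := by gcongr; exact hSB _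
    _ = ε ^ 2 / (2 * S) * (w₀ - w₀ / 2) := by field_simp; ring
    _ ≤ ε ^ 2 / (2 * S) * (w₀ - ε ^ 2 * C 0 / S) := by
      have : ε ^ 2 * C 0 / S ≤ w₀ / 2 := le_trans (by gcongr) h1
      gcongr
    _ ≤ levelVar P X 0 / numSamples P X C α cα ε 0 := le_div_max_ceil hV0.le hC0 hS0 hε
    _ ≤ estimatorVar P X C α cα ε :=
      Finset.single_le_sum (f := fun ℓ => levelVar P X ℓ / numSamples P X C α cα ε ℓ)
        (fun ℓ _ => div_nonneg (levelVar_nonneg P X ℓ) (Nat.cast_nonneg _))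
        (Finset.mem_range.2 (Nat.succ_pos _))

/-- The estimator has variance of the order `ε²` when `S_k` grows fast enough. -/
lemma RateAssumption.le_estimatorVar_of_tendsto (h : RateAssumption P Xlim X C α β γ cα)
    (hV0 : 0 < levelVar P X 0)
    (hS : Tendsto (fun k : ℕ => Real.exp ((γ - 2 * α) * k) / levelSum P X C k ^ 2) atTop (𝓝 0)) :
    ∃ κ > 0, ∀ᶠ ε : ℝ in 𝓝[>] 0, κ * ε ^ 2 ≤ estimatorVar P X C α cα ε := by
  obtain ⟨A, hA, hAC⟩ := h.sum_cost_le
  have hlim : Tendsto (fun ε : ℝ => (cα * Real.exp α) ^ 2 * A *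
      (Real.exp ((γ - 2 * α) * numLevels α cα ε) /
        levelSum P X C (numLevels α cα ε) ^ 2)) (𝓝[>] 0) (𝓝 0) := by
    simpa using (hS.comp (tendsto_numLevels h.alpha_pos h.const_pos)).const_mul
      ((cα * Real.exp α) ^ 2 * A)
  -- One factor `1/2` comes from `le_div_max_ceil`, the other from a rounding loss of at most `1/2`
  -- (`hcost`).
  refine ⟨1 / 4, by norm_num, ?_⟩
  filter_upwards [hlim.eventually (gt_mem_nhds (half_pos one_pos)), self_mem_nhdsWithin,
    eventually_mul_exp_numLevels_le h.alpha_pos h.const_pos] with ε h1 hε h2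
  have hε : 0 < ε := hε
  set L := numLevels α cα ε with hL
  set S := levelSum P X C L with hSdef
  have hS0 : 0 < S := levelSum_pos hV0 (h.cost_pos 0) _
  have hcost : ε ^ 2 * (∑ ℓ ∈ Finset.range (L + 1), C ℓ) / S ^ 2 ≤ 1 / 2 := by
    refine le_trans ?_ h1.le
    rw [← mul_div_assoc]
    refine div_le_div_of_nonneg_right ?_ (sq_nonneg _)
    have e : Real.exp (γ * L) = Real.exp (α * L) ^ 2 * Real.exp ((γ - 2 * α) * L) := by
      rw [← Real.exp_nat_mul, ← Real.exp_add]
      congr 1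
      push_cast
      ring
    calc ε ^ 2 * (∑ ℓ ∈ Finset.range (L + 1), C ℓ) ≤ ε ^ 2 * (A * Real.exp (γ * L)) := by
          gcongr
          exact hAC L
      _ = (ε * Real.exp (α * L)) ^ 2 * A * Real.exp ((γ - 2 * α) * L) := by rw [e]; ring
      _ ≤ _ := by gcongr
  calc 1 / 4 * ε ^ 2 = ε ^ 2 / 2 * (1 - 1 / 2) := by ring
    _ ≤ ε ^ 2 / 2 * (1 - ε ^ 2 * (∑ ℓ ∈ Finset.range (L + 1), C ℓ) / S ^ 2) := by gcongr
    _ = ε ^ 2 / (2 * S) * (S - ε ^ 2 * (∑ ℓ ∈ Finset.range (L + 1), C ℓ) / S) := by field_simp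
    _ = ∑ ℓ ∈ Finset.range (L + 1),
        ε ^ 2 / (2 * S) * (√(levelVar P X ℓ * C ℓ) - ε ^ 2 * C ℓ / S) := by
      rw [← Finset.mul_sum, Finset.sum_sub_distrib, ← Finset.sum_div, ← Finset.mul_sum]
      rfl
    _ ≤ estimatorVar P X C α cα ε := Finset.sum_le_sum fun ℓ _ =>
      le_div_max_ceil (levelVar_nonneg P X ℓ) (h.cost_pos ℓ) hS0 hε

end Levels

end MLMC

namespace MLMC

/-! ### Tails of the level fluctuations and the Lindeberg sum. -/

section Fluctuations

variable {Ω : Type*} [MeasurableSpace Ω] {P : Measure Ω} {Xlim : Ω → ℝ} {X : ℕ → Ω → ℝ}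
  {C : ℕ → ℝ} {α β γ cα : ℝ}

lemma memLp_increment (hX : ∀ ℓ, MemLp (X ℓ) 2 P) (ℓ : ℕ) : MemLp (increment X ℓ) 2 P := by
  cases ℓ with
  | zero => exact hX 0
  | succ ℓ => exact (hX (ℓ + 1)).sub (hX ℓ)

lemma sum_integral_increment [IsProbabilityMeasure P] (hX : ∀ ℓ, MemLp (X ℓ) 2 P) (k : ℕ) :
    ∑ ℓ ∈ Finset.range (k + 1), ∫ ω, increment X ℓ ω ∂P = ∫ ω, X k ω ∂P := by
  have hi : ∀ ℓ, Integrable (X ℓ) P := fun ℓ => (hX ℓ).integrable (by norm_num)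
  induction k with
  | zero => simp [increment]
  | succ k ih =>
    rw [Finset.sum_range_succ, ih]
    simp only [increment]
    rw [integral_sub (hi _) (hi _)]
    ring

lemma normSq_nonneg (P : Measure Ω) (X : ℕ → Ω → ℝ) (ℓ : ℕ) (ω : Ω) : 0 ≤ normSq P X ℓ ω :=
  div_nonneg (sq_nonneg _) (levelVar_nonneg P X ℓ)

lemma integrable_normSq [IsProbabilityMeasure P] (hX : ∀ ℓ, MemLp (X ℓ) 2 P) (ℓ : ℕ) :
    Integrable (normSq P X ℓ) P := by
  unfold normSq
  simp only [sq_abs]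
  exact ((memLp_increment hX ℓ).sub (memLp_const _)).integrable_sq.div_const _

/-- Equality fails only when `V_ℓ = 0`, where division by zero makes `normSq` vanish. -/
lemma integral_normSq_le_one (hX : ∀ ℓ, MemLp (X ℓ) 2 P) (ℓ : ℕ) :
    ∫ ω, normSq P X ℓ ω ∂P ≤ 1 := by
  unfold normSq
  simp only [sq_abs]
  rw [integral_div, ← variance_eq_integral (memLp_increment hX ℓ).1.aemeasurable]
  exact div_self_le_one _

lemma upperTail_normSq_le_one [IsProbabilityMeasure P] (hX : ∀ ℓ, MemLp (X ℓ) 2 P) (ℓ : ℕ)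
    (a : ℝ) : upperTail P (normSq P X ℓ) a ≤ 1 :=
  (upperTail_le_integral (normSq_nonneg P X ℓ) (integrable_normSq hX ℓ) a).trans
    (integral_normSq_le_one hX ℓ)

/-- The indicator of `V_ℓ > 0` can be dropped because `normSq` is zero when `V_ℓ = 0`. -/
lemma TailCondition.tendsto_upperTail (h : TailCondition P X C α γ) {ν : ℝ} (hν : 0 < ν) :
    Tendsto (fun ℓ : ℕ => upperTail P (normSq P X ℓ)
      (ν * levelSum P X C ℓ ^ 2 * Real.exp ((2 * α - γ) * ℓ))) atTop (𝓝 0) := by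
  refine (h ν hν).congr fun ℓ => ?_
  split_ifs with hV
  · rfl
  · have hV' : levelVar P X ℓ = 0 := le_antisymm (not_lt.1 hV) (levelVar_nonneg P X ℓ)
    simp [upperTail, normSq, hV']

/-- The fluctuations of the fine levels are asymptotically negligible in the `S`-weighted mean. -/
def NegligibleTails (P : Measure Ω) (X : ℕ → Ω → ℝ) (C : ℕ → ℝ) (α γ : ℝ) : Prop :=
  ∀ ν : ℝ, 0 < ν → ∀ η : ℝ, 0 < η → ∃ N : ℕ, ∀ k : ℕ,
    ∑ ℓ ∈ Finset.Ico N (k + 1), √(levelVar P X ℓ * C ℓ) * upperTail P (normSq P X ℓ)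
      (ν * levelSum P X C ℓ ^ 2 * Real.exp ((2 * α - γ) * ℓ)) ≤ η * levelSum P X C k

lemma TailCondition.negligibleTails (h : TailCondition P X C α γ) :
    NegligibleTails P X C α γ := by
  intro ν hν η hη
  obtain ⟨N, hN⟩ := eventually_atTop.1 ((h.tendsto_upperTail hν).eventually (gt_mem_nhds hη))
  refine ⟨N, fun k => ?_⟩
  calc _ ≤ ∑ ℓ ∈ Finset.Ico N (k + 1), √(levelVar P X ℓ * C ℓ) * η := by
        refine Finset.sum_le_sum fun ℓ hℓ => ?_
        gcongr
        exact (hN ℓ (Finset.mem_Ico.1 hℓ).1).le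
    _ ≤ ∑ ℓ ∈ Finset.range (k + 1), √(levelVar P X ℓ * C ℓ) * η := by
        refine Finset.sum_le_sum_of_subset_of_nonneg (fun ℓ hℓ => ?_) fun _ _ _ => by positivity
        exact Finset.mem_range.2 (Finset.mem_Ico.1 hℓ).2
    _ = η * levelSum P X C k := by rw [← Finset.sum_mul, mul_comm, levelSum]

/-- Each tail is at most one, so the sum is bounded by a remainder of a convergent series, made
smaller than `η w_0 ≤ η S_k`; the thresholds play no role. -/
lemma negligibleTails_of_summable [IsProbabilityMeasure P] (hX : ∀ ℓ, MemLp (X ℓ) 2 P)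
    (hpos : 0 < √(levelVar P X 0 * C 0))
    (hs : Summable fun ℓ => √(levelVar P X ℓ * C ℓ)) : NegligibleTails P X C α γ := by
  intro ν _ η hη
  obtain ⟨N, hN⟩ := eventually_atTop.1 (hs.hasSum.tendsto_sum_nat.eventually
    (lt_mem_nhds (sub_lt_self _ (mul_pos hη hpos))))
  refine ⟨N, fun k => ?_⟩
  rcases le_or_gt N (k + 1) with hk | hk
  · calc _ ≤ ∑ ℓ ∈ Finset.Ico N (k + 1), √(levelVar P X ℓ * C ℓ) :=
          Finset.sum_le_sum fun ℓ _ =>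
            mul_le_of_le_one_right (Real.sqrt_nonneg _) (upperTail_normSq_le_one hX ℓ _)
      _ = levelSum P X C k - ∑ ℓ ∈ Finset.range N, √(levelVar P X ℓ * C ℓ) :=
          Finset.sum_Ico_eq_sub _ hk
      _ ≤ η * √(levelVar P X 0 * C 0) := by
          have h1 := hN N le_rfl
          have h2 : levelSum P X C k ≤ ∑' ℓ, √(levelVar P X ℓ * C ℓ) :=
            hs.sum_le_tsum _ fun _ _ => Real.sqrt_nonneg _
          linarith
      _ ≤ _ := by
          gcongr
          exact sqrt_le_levelSum P X C (Nat.zero_le k)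
  · rw [Finset.Ico_eq_empty (by omega), Finset.sum_empty]
    have : 0 ≤ levelSum P X C k := Finset.sum_nonneg fun _ _ => Real.sqrt_nonneg _
    positivity

/-- The Lindeberg sum of the multilevel estimator, in terms of the fluctuations of the levels. -/
lemma tendsto_lindeberg_sum [IsProbabilityMeasure P] (h : RateAssumption P Xlim X C α β γ cα)
    (hX : ∀ ℓ, MemLp (X ℓ) 2 P) (hV0 : 0 < levelVar P X 0) (hT : NegligibleTails P X C α γ)
    {κ : ℝ} (hκ : 0 < κ)
    (hvar : ∀ᶠ ε : ℝ in 𝓝[>] 0, κ * ε ^ 2 ≤ estimatorVar P X C α cα ε)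
    {δ : ℝ} (hδ : 0 < δ) :
    Tendsto (fun ε : ℝ => ∑ ℓ ∈ Finset.range (numLevels α cα ε + 1),
      levelVar P X ℓ / numSamples P X C α cα ε ℓ / estimatorVar P X C α cα ε *
        upperTail P (normSq P X ℓ) (δ ^ 2 * (estimatorVar P X C α cα ε *
          (numSamples P X C α cα ε ℓ : ℝ) ^ 2 / levelVar P X ℓ))) (𝓝[>] 0) (𝓝 0) := by
  obtain ⟨c, hc, K, hK, hC⟩ := h.cost_growth
  have hK0 : 0 < K := hc.trans hK
  have hcα := h.const_pos
  set q := cα * Real.exp α with hq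
  have hq0 : 0 < q := by positivity
  set w : ℕ → ℝ := fun ℓ => √(levelVar P X ℓ * C ℓ) with hw
  set T : ℕ → ℝ → ℝ := fun ℓ => upperTail P (normSq P X ℓ) with hTdef
  have hT0 : ∀ ℓ a, 0 ≤ T ℓ a := fun ℓ a => upperTail_nonneg (normSq_nonneg P X ℓ) a
  have hTanti : ∀ ℓ, Antitone (T ℓ) := fun ℓ =>
    upperTail_antitone (normSq_nonneg P X ℓ) (integrable_normSq hX ℓ)
  -- The constant left after inserting `ε e^{αL} ≤ q` and `C_ℓ < K e^{γℓ}` into the threshold.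
  set ν := δ ^ 2 * κ / (q ^ 2 * K) with hν
  have hν0 : 0 < ν := by positivity
  have hS0 : ∀ k, 0 < levelSum P X C k := levelSum_pos hV0 (h.cost_pos 0)
  -- a bound for each term of the sum
  have hterm : ∀ᶠ ε : ℝ in 𝓝[>] 0, ∀ ℓ ∈ Finset.range (numLevels α cα ε + 1),
      levelVar P X ℓ / numSamples P X C α cα ε ℓ / estimatorVar P X C α cα ε *
        T ℓ (δ ^ 2 * (estimatorVar P X C α cα ε *
          (numSamples P X C α cα ε ℓ : ℝ) ^ 2 / levelVar P X ℓ))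
      ≤ w ℓ / (κ * levelSum P X C (numLevels α cα ε)) *
        T ℓ (δ ^ 2 * (κ * (ε ^ 2)⁻¹ * levelSum P X C (numLevels α cα ε) ^ 2 / C ℓ)) := by
    filter_upwards [hvar, self_mem_nhdsWithin] with ε h1 hε ℓ hℓ
    have hε : 0 < ε := hε
    have hS := hS0 (numLevels α cα ε)
    have hσ : 0 < estimatorVar P X C α cα ε := lt_of_lt_of_le (by positivity) h1
    rcases (levelVar_nonneg P X ℓ).eq_or_lt with hV | hV
    · rw [← hV, zero_div, zero_div, zero_mul]
      have := hT0 ℓ (δ ^ 2 * (κ * (ε ^ 2)⁻¹ * levelSum P X C (numLevels α cα ε) ^ 2 / C ℓ))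
      have hw0 : 0 ≤ w ℓ := Real.sqrt_nonneg _
      positivity
    · have h2 : levelVar P X ℓ / numSamples P X C α cα ε ℓ / estimatorVar P X C α cα ε
          ≤ w ℓ / (κ * levelSum P X C (numLevels α cα ε)) := by
        have h3 : levelVar P X ℓ / numSamples P X C α cα ε ℓ
            ≤ ε ^ 2 * w ℓ / levelSum P X C (numLevels α cα ε) :=
          div_max_ceil_le hV.le (h.cost_pos ℓ) hS hε
        have hw0 : 0 ≤ w ℓ := Real.sqrt_nonneg _
        calc _ ≤ ε ^ 2 * w ℓ / levelSum P X C (numLevels α cα ε) / (κ * ε ^ 2) := by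
              gcongr
          _ = _ := by field_simp
      have h3 : T ℓ (δ ^ 2 * (estimatorVar P X C α cα ε *
          (numSamples P X C α cα ε ℓ : ℝ) ^ 2 / levelVar P X ℓ))
          ≤ T ℓ (δ ^ 2 * (κ * (ε ^ 2)⁻¹ * levelSum P X C (numLevels α cα ε) ^ 2 / C ℓ)) := by
        refine hTanti ℓ (mul_le_mul_of_nonneg_left ?_ (sq_nonneg δ))
        exact le_mul_sq_max_ceil_div hV (h.cost_pos ℓ) hS hε hκ.le h1
      exact mul_le_mul h2 h3 (hT0 _ _) (div_nonneg (Real.sqrt_nonneg _) (by positivity))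
  -- the coarse levels
  have hcoarse : ∀ N : ℕ, Tendsto (fun ε : ℝ => ∑ ℓ ∈ Finset.range N,
      1 / κ * T ℓ (δ ^ 2 * (κ * (ε ^ 2)⁻¹ * levelSum P X C 0 ^ 2 / C ℓ))) (𝓝[>] 0) (𝓝 0) := by
    intro N
    suffices Tendsto (fun ε : ℝ => ∑ ℓ ∈ Finset.range N,
        1 / κ * T ℓ (δ ^ 2 * (κ * (ε ^ 2)⁻¹ * levelSum P X C 0 ^ 2 / C ℓ))) (𝓝[>] 0)
        (𝓝 (∑ ℓ ∈ Finset.range N, 1 / κ * 0)) by simpa using this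
    refine tendsto_finsetSum _ fun ℓ _ => ?_
    refine ((tendsto_upperTail_atTop (integrable_normSq hX ℓ)).comp ?_).const_mul _
    have hsq : Tendsto (fun ε : ℝ => (ε ^ 2)⁻¹) (𝓝[>] 0) atTop := by
      simp_rw [← inv_pow]
      exact (tendsto_pow_atTop two_ne_zero).comp tendsto_inv_nhdsGT_zero
    have hCℓ := h.cost_pos ℓ
    have hSq := hS0 0
    have := hsq.const_mul_atTop (show 0 < δ ^ 2 * κ * levelSum P X C 0 ^ 2 / C ℓ by positivity)
    refine this.congr fun ε => ?_
    ring
  rw [Metric.tendsto_nhds]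
  intro η hη
  -- The factor `κ` cancels the one in the weight `w_ℓ / (κ S_L)`.
  obtain ⟨N, hN⟩ := hT ν hν0 (κ * (η / 2)) (by positivity)
  filter_upwards [hterm, (hcoarse N).eventually (gt_mem_nhds (half_pos hη)), hvar,
    self_mem_nhdsWithin, eventually_mul_exp_numLevels_le h.alpha_pos h.const_pos]
    with ε h1 h2 h3 hε h4
  have hε : 0 < ε := hε
  have hσ : 0 < estimatorVar P X C α cα ε := lt_of_lt_of_le (by positivity) h3
  set L := numLevels α cα ε with hL
  have hS := hS0 L
  rw [dist_zero_right, Real.norm_of_nonneg]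
  swap
  · exact Finset.sum_nonneg fun ℓ _ => mul_nonneg (div_nonneg (div_nonneg
      (levelVar_nonneg P X ℓ) (Nat.cast_nonneg _)) hσ.le) (hT0 _ _)
  -- Coarse levels use `w_ℓ ≤ S_L` and `S_0 ≤ S_L`; fine levels keep their weight and pass to the
  -- threshold of the tail condition.
  have hbound : ∀ ℓ ∈ Finset.range (L + 1), w ℓ / (κ * levelSum P X C L) *
        T ℓ (δ ^ 2 * (κ * (ε ^ 2)⁻¹ * levelSum P X C L ^ 2 / C ℓ))
      ≤ if ℓ < N then 1 / κ * T ℓ (δ ^ 2 * (κ * (ε ^ 2)⁻¹ * levelSum P X C 0 ^ 2 / C ℓ))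
        else (κ * levelSum P X C L)⁻¹ * (w ℓ *
          T ℓ (ν * levelSum P X C ℓ ^ 2 * Real.exp ((2 * α - γ) * ℓ))) := by
    intro ℓ hℓ
    have hℓL : ℓ ≤ L := by have := Finset.mem_range.1 hℓ; omega
    have hCℓ := h.cost_pos ℓ
    have hw0 : 0 ≤ w ℓ := Real.sqrt_nonneg _
    split_ifs with hℓN
    · refine mul_le_mul ?_ (hTanti ℓ ?_) (hT0 _ _) (by positivity)
      · rw [div_le_div_iff₀ (by positivity) hκ]
        nlinarith [sqrt_le_levelSum P X C hℓL]
      · have := levelSum_mono P X C (Nat.zero_le L)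
        have := (hS0 0).le
        gcongr
    · rw [div_eq_inv_mul, mul_assoc]
      refine mul_le_mul_of_nonneg_left (mul_le_mul_of_nonneg_left (hTanti ℓ ?_) hw0)
        (by positivity)
      have hεL : Real.exp (2 * α * ℓ) ≤ q ^ 2 * (ε ^ 2)⁻¹ := by
        rw [← div_eq_mul_inv, le_div_iff₀ (by positivity)]
        have hm : Real.exp (α * ℓ) ≤ Real.exp (α * L) := by
          have := h.alpha_pos.le
          gcongr
        calc Real.exp (2 * α * ℓ) * ε ^ 2 = (ε * Real.exp (α * ℓ)) ^ 2 := by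
              rw [mul_pow, ← Real.exp_nat_mul, mul_comm]
              push_cast
              ring_nf
          _ ≤ (ε * Real.exp (α * L)) ^ 2 := by gcongr
          _ ≤ q ^ 2 := by gcongr
      have hCle : (Real.exp (γ * ℓ))⁻¹ ≤ K / C ℓ := by
        rw [le_div_iff₀ hCℓ, inv_mul_le_iff₀ (Real.exp_pos _), mul_comm]
        exact (hC ℓ).2.le
      have hSS := levelSum_mono P X C hℓL
      have := (hS0 ℓ).le
      calc ν * levelSum P X C ℓ ^ 2 * Real.exp ((2 * α - γ) * ℓ)
          = ν * levelSum P X C ℓ ^ 2 * (Real.exp (2 * α * ℓ) * (Real.exp (γ * ℓ))⁻¹) := by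
            rw [← Real.exp_neg, ← Real.exp_add]
            ring_nf
        _ ≤ ν * levelSum P X C L ^ 2 * (q ^ 2 * (ε ^ 2)⁻¹ * (K / C ℓ)) := by gcongr
        _ = _ := by rw [hν]; field_simp
  calc _ ≤ _ := (Finset.sum_le_sum h1).trans (Finset.sum_le_sum hbound)
    _ = ∑ ℓ ∈ Finset.range (L + 1) with ℓ < N,
          1 / κ * T ℓ (δ ^ 2 * (κ * (ε ^ 2)⁻¹ * levelSum P X C 0 ^ 2 / C ℓ))
        + (κ * levelSum P X C L)⁻¹ * ∑ ℓ ∈ Finset.Ico N (L + 1), w ℓ *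
          T ℓ (ν * levelSum P X C ℓ ^ 2 * Real.exp ((2 * α - γ) * ℓ)) := by
        rw [Finset.sum_ite, Finset.mul_sum]
        congr 2
        ext ℓ
        simp only [Finset.mem_filter, Finset.mem_range, Finset.mem_Ico]
        omega
    _ ≤ ∑ ℓ ∈ Finset.range N,
          1 / κ * T ℓ (δ ^ 2 * (κ * (ε ^ 2)⁻¹ * levelSum P X C 0 ^ 2 / C ℓ))
        + (κ * levelSum P X C L)⁻¹ * (κ * (η / 2) * levelSum P X C L) := by
        refine add_le_add ?_ (mul_le_mul_of_nonneg_left (hN L) (by positivity))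
        · refine Finset.sum_le_sum_of_subset_of_nonneg (fun ℓ hℓ => ?_) fun ℓ _ _ =>
            mul_nonneg (by positivity) (hT0 _ _)
          exact Finset.mem_range.2 (Finset.mem_filter.1 hℓ).2
    _ < η / 2 + η / 2 := by
        refine add_lt_add_of_lt_of_le h2 (le_of_eq ?_)
        field_simp
    _ = η := add_halves η

end Fluctuations

/-! ### The estimator as a sum of independent samples. -/

section Sampling

variable {Ω : Type*} [MeasurableSpace Ω] {P : Measure Ω} {X : ℕ → Ω → ℝ}
  {C : ℕ → ℝ} {α cα : ℝ} {Y : ℕ → ℕ → Ω → ℝ}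

lemma numSamples_pos (P : Measure Ω) (X : ℕ → Ω → ℝ) (C : ℕ → ℝ) (α cα ε : ℝ) (ℓ : ℕ) :
    (0 : ℝ) < numSamples P X C α cα ε ℓ := by
  exact_mod_cast (le_max_right _ 1 : 1 ≤ numSamples P X C α cα ε ℓ)

/-- The index set of the samples used by the estimator. -/
noncomputable def sampleIndices (P : Measure Ω) (X : ℕ → Ω → ℝ) (C : ℕ → ℝ) (α cα ε : ℝ) :
    Finset ((_ : ℕ) × ℕ) :=
  (Finset.range (numLevels α cα ε + 1)).sigma fun ℓ => Finset.range (numSamples P X C α cα ε ℓ)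

lemma IsSampling.iIndepFun_sigma (hY : IsSampling P X Y) :
    iIndepFun (fun p : (_ : ℕ) × ℕ => Y p.1 p.2) P :=
  hY.indep.precomp (g := fun p : (_ : ℕ) × ℕ => (p.1, p.2)) fun p q hpq => by
    obtain ⟨a, b⟩ := p
    obtain ⟨c, d⟩ := q
    simp_all

lemma IsSampling.memLp (hY : IsSampling P X Y) (hX : ∀ ℓ, MemLp (X ℓ) 2 P) (ℓ i : ℕ) :
    MemLp (Y ℓ i) 2 P :=
  (hY.identDistrib ℓ i).memLp_iff.2 (memLp_increment hX ℓ)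

lemma IsSampling.variance_estimator [IsProbabilityMeasure P] (hY : IsSampling P X Y)
    (hX : ∀ ℓ, MemLp (X ℓ) 2 P) (ε : ℝ) :
    Var[estimator P X C Y α cα ε; P] = estimatorVar P X C α cα ε := by
  have e : estimator P X C Y α cα ε = ∑ p ∈ sampleIndices P X C α cα ε,
      fun ω => (numSamples P X C α cα ε p.1 : ℝ)⁻¹ * Y p.1 p.2 ω := by
    ext ω
    simp only [estimator, sampleIndices, Finset.sum_apply, Finset.sum_sigma, div_eq_inv_mul]
  rw [e, IndepFun.variance_sum, sampleIndices, Finset.sum_sigma]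
  · refine Finset.sum_congr rfl fun ℓ _ => ?_
    have hM := numSamples_pos P X C α cα ε ℓ
    simp_rw [variance_const_mul, (hY.identDistrib ℓ _).variance_eq]
    rw [Finset.sum_const, Finset.card_range, nsmul_eq_mul, levelVar]
    field_simp
  · exact fun p _ => (hY.memLp hX p.1 p.2).const_mul _
  · intro p _ q _ hpq
    exact (hY.iIndepFun_sigma.indepFun hpq).comp
      (measurable_const_mul _) (measurable_const_mul _)

/-- The centered and normalized contribution of one sample to the estimator. -/
noncomputable def normalizedSample (P : Measure Ω) (X : ℕ → Ω → ℝ) (C : ℕ → ℝ)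
    (Y : ℕ → ℕ → Ω → ℝ) (α cα ε : ℝ) (p : (_ : ℕ) × ℕ) (ω : Ω) : ℝ :=
  (numSamples P X C α cα ε p.1 * √(estimatorVar P X C α cα ε))⁻¹ *
    (Y p.1 p.2 ω - ∫ ω', increment X p.1 ω' ∂P)

lemma IsSampling.normalizedEstimator_eq [IsProbabilityMeasure P] (hY : IsSampling P X Y)
    (hX : ∀ ℓ, MemLp (X ℓ) 2 P) (ε : ℝ) (ω : Ω) :
    normalizedEstimator P X C Y α cα ε ω
      = ∑ p ∈ sampleIndices P X C α cα ε, normalizedSample P X C Y α cα ε p ω := by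
  rw [normalizedEstimator, hY.variance_estimator hX, ← sum_integral_increment hX, estimator,
    ← Finset.sum_sub_distrib, Finset.sum_div, sampleIndices, Finset.sum_sigma]
  refine Finset.sum_congr rfl fun ℓ _ => ?_
  have hM := (numSamples_pos P X C α cα ε ℓ).ne'
  simp only [normalizedSample]
  rw [← Finset.mul_sum, ← Finset.sum_div, Finset.sum_sub_distrib, Finset.sum_const,
    Finset.card_range, nsmul_eq_mul]
  field_simp

lemma IsSampling.memLp_normalizedSample [IsProbabilityMeasure P] (hY : IsSampling P X Y)
    (hX : ∀ ℓ, MemLp (X ℓ) 2 P) (ε : ℝ) (p : (_ : ℕ) × ℕ) :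
    MemLp (normalizedSample P X C Y α cα ε p) 2 P :=
  ((hY.memLp hX p.1 p.2).sub (memLp_const _)).const_mul _

lemma IsSampling.integral_normalizedSample [IsProbabilityMeasure P] (hY : IsSampling P X Y)
    (hX : ∀ ℓ, MemLp (X ℓ) 2 P) (ε : ℝ) (p : (_ : ℕ) × ℕ) :
    ∫ ω, normalizedSample P X C Y α cα ε p ω ∂P = 0 := by
  unfold normalizedSample
  rw [integral_const_mul, integral_sub ((hY.memLp hX p.1 p.2).integrable (by norm_num))
    (integrable_const _), (hY.identDistrib p.1 p.2).integral_eq]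
  simp

lemma IsSampling.identDistrib_normalizedSample_sq (hY : IsSampling P X Y) (ε : ℝ)
    (p : (_ : ℕ) × ℕ) :
    IdentDistrib (fun ω => normalizedSample P X C Y α cα ε p ω ^ 2)
      (fun ω => ((numSamples P X C α cα ε p.1 * √(estimatorVar P X C α cα ε))⁻¹ *
        (increment X p.1 ω - ∫ ω', increment X p.1 ω' ∂P)) ^ 2) P P :=
  (hY.identDistrib p.1 p.2).comp
    (u := fun x => ((numSamples P X C α cα ε p.1 * √(estimatorVar P X C α cα ε))⁻¹ *
        (x - ∫ ω', increment X p.1 ω' ∂P)) ^ 2) (by fun_prop)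

lemma IsSampling.integral_normalizedSample_sq (hY : IsSampling P X Y)
    (hX : ∀ ℓ, MemLp (X ℓ) 2 P) {ε : ℝ} (hσ : 0 ≤ estimatorVar P X C α cα ε)
    (p : (_ : ℕ) × ℕ) :
    ∫ ω, normalizedSample P X C Y α cα ε p ω ^ 2 ∂P
      = levelVar P X p.1 / (numSamples P X C α cα ε p.1 ^ 2 * estimatorVar P X C α cα ε) := by
  rw [(hY.identDistrib_normalizedSample_sq ε p).integral_eq]
  simp_rw [mul_pow]
  rw [integral_const_mul, ← variance_eq_integral (memLp_increment hX p.1).1.aemeasurable, inv_pow,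
    mul_pow, Real.sq_sqrt hσ, levelVar]
  ring

/-- For `V_ℓ > 0` the squared sample has the law of `c Q_ℓ` with `c = V_ℓ / (M_ℓ² σ²)`, so the
factor `c` comes out and the threshold is divided by it. -/
lemma IsSampling.upperTail_normalizedSample_sq [IsProbabilityMeasure P] (hY : IsSampling P X Y)
    (hX : ∀ ℓ, MemLp (X ℓ) 2 P) {ε : ℝ} (hσ : 0 < estimatorVar P X C α cα ε) (δ : ℝ)
    (p : (_ : ℕ) × ℕ) :
    upperTail P (fun ω => normalizedSample P X C Y α cα ε p ω ^ 2) (δ ^ 2)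
      = levelVar P X p.1 / (numSamples P X C α cα ε p.1 ^ 2 * estimatorVar P X C α cα ε) *
        upperTail P (normSq P X p.1) (δ ^ 2 * (estimatorVar P X C α cα ε *
          (numSamples P X C α cα ε p.1 : ℝ) ^ 2 / levelVar P X p.1)) := by
  have hM := numSamples_pos P X C α cα ε p.1
  rcases (levelVar_nonneg P X p.1).eq_or_lt with hV | hV
  · refine le_antisymm ?_ ?_
    · refine (upperTail_le_integral (fun _ => sq_nonneg _)
        (hY.memLp_normalizedSample hX ε p).integrable_sq _).trans ?_
      rw [hY.integral_normalizedSample_sq hX hσ.le, ← hV]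
      simp
    · rw [← hV, zero_div, zero_mul]
      exact upperTail_nonneg (fun _ => sq_nonneg _) _
  · rw [(hY.identDistrib_normalizedSample_sq ε p).upperTail_eq, ← upperTail_const_mul _
      (by positivity)]
    congr 1
    · ext ω
      rw [normSq, sq_abs, mul_pow, inv_pow, mul_pow, Real.sq_sqrt hσ.le]
      field_simp
    · field_simp

/-- Lindeberg's theorem for the multilevel estimator. -/
lemma IsSampling.tendstoInDistribution_normalizedEstimator [IsProbabilityMeasure P]
    {Xlim : Ω → ℝ} {β γ : ℝ} (hY : IsSampling P X Y)
    (h : RateAssumption P Xlim X C α β γ cα) (hX : ∀ ℓ, MemLp (X ℓ) 2 P)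
    (hV0 : 0 < levelVar P X 0) (hT : NegligibleTails P X C α γ)
    (hvar : ∃ κ > 0, ∀ᶠ ε : ℝ in 𝓝[>] 0, κ * ε ^ 2 ≤ estimatorVar P X C α cα ε) :
    TendstoInDistribution (fun (ε : ℝ) => normalizedEstimator P X C Y α cα ε)
      (𝓝[>] (0 : ℝ)) (id : ℝ → ℝ) (fun _ => P) (gaussianReal 0 1) := by
  obtain ⟨κ, hκ, hvar⟩ := hvar
  have hσ : ∀ᶠ ε : ℝ in 𝓝[>] 0, 0 < estimatorVar P X C α cα ε := by
    filter_upwards [hvar, self_mem_nhdsWithin] with ε h1 hε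
    have hε : 0 < ε := hε
    exact lt_of_lt_of_le (by positivity) h1
  have e : (fun (ε : ℝ) => normalizedEstimator P X C Y α cα ε) = fun ε ω =>
      ∑ p ∈ sampleIndices P X C α cα ε, normalizedSample P X C Y α cα ε p ω := by
    ext ε ω
    exact hY.normalizedEstimator_eq hX ε ω
  rw [e]
  refine tendstoInDistribution_sum_of_lindeberg _ _ (hY.memLp_normalizedSample hX)
    (hY.integral_normalizedSample hX) (fun ε => ?_) ?_ fun δ hδ => ?_
  · exact hY.iIndepFun_sigma.comp
      (fun p x => (numSamples P X C α cα ε p.1 * √(estimatorVar P X C α cα ε))⁻¹ *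
        (x - ∫ ω', increment X p.1 ω' ∂P)) fun p => by fun_prop
  · filter_upwards [hσ] with ε hε
    simp_rw [hY.integral_normalizedSample_sq hX hε.le]
    rw [sampleIndices, Finset.sum_sigma, ← div_self hε.ne']
    conv_rhs => rw [estimatorVar, Finset.sum_div]
    refine Finset.sum_congr rfl fun ℓ _ => ?_
    have hM := numSamples_pos P X C α cα ε ℓ
    dsimp only
    rw [Finset.sum_const, Finset.card_range, nsmul_eq_mul]
    change _ = _ / estimatorVar P X C α cα ε
    field_simp
  · refine (tendsto_lindeberg_sum h hX hV0 hT hκ hvar hδ).congr' ?_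
    filter_upwards [hσ] with ε hε
    simp_rw [hY.upperTail_normalizedSample_sq hX hε]
    rw [sampleIndices, Finset.sum_sigma]
    -- The `M_ℓ` equal terms of a level turn `V_ℓ / (M_ℓ² σ²)` into `V_ℓ / (M_ℓ σ²)`.
    refine Finset.sum_congr rfl fun ℓ _ => ?_
    have hM := numSamples_pos P X C α cα ε ℓ
    dsimp only
    rw [Finset.sum_const, Finset.card_range, nsmul_eq_mul, ← mul_assoc]
    congr 1
    field_simp

end Sampling

end MLMC

/-! ### The central limit theorem for the multilevel estimator. -/

theorem theorem1 {Ω : Type*} [MeasurableSpace Ω] (P : Measure Ω) [IsProbabilityMeasure P]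
    (Xlim : Ω → ℝ) (hXlim : MemLp Xlim 2 P)
    (X : ℕ → Ω → ℝ) (hX : ∀ ℓ, MemLp (X ℓ) 2 P)
    (C : ℕ → ℝ) (α β γ cα : ℝ)
    (hrates : MLMC.RateAssumption P Xlim X C α β γ cα)
    (Y : ℕ → ℕ → Ω → ℝ) (hY : MLMC.IsSampling P X Y)
    (hV0 : 0 < MLMC.levelVar P X 0)
    (h_eq : β = γ →
      Tendsto (MLMC.levelSum P X C) atTop atTop ∧ MLMC.TailCondition P X C α γ)
    (h_lt : β < γ →
      β < 2 * α ∧ MLMC.TailCondition P X C α γ ∧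
        ∃ υ : ℝ, β ≤ υ ∧ υ < 2 * α ∧
          ∀ᶠ k : ℕ in atTop,
            1 < MLMC.levelSum P X C k * Real.exp ((υ - γ) * k / 2)) :
    TendstoInDistribution (fun (ε : ℝ) => MLMC.normalizedEstimator P X C Y α cα ε)
      (𝓝[>] (0 : ℝ)) (id : ℝ → ℝ) (fun _ => P) (gaussianReal 0 1) := by
  -- For `γ < β` summability replaces both the tail condition and the growth of `S_k`.
  rcases lt_or_ge γ β with hlt | hge
  · exact hY.tendstoInDistribution_normalizedEstimator hrates hX hV0
      (MLMC.negligibleTails_of_summable hX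
        (Real.sqrt_pos.2 (mul_pos hV0 (hrates.cost_pos 0))) (hrates.summable_sqrt hlt))
      (hrates.le_estimatorVar_of_lt hV0 hlt)
  · have hT : MLMC.TailCondition P X C α γ :=
      hge.eq_or_lt.elim (fun h => (h_eq h).2) fun h => (h_lt h).2.1
    refine hY.tendstoInDistribution_normalizedEstimator hrates hX hV0 hT.negligibleTails
      (hrates.le_estimatorVar_of_tendsto hV0 (MLMC.tendsto_exp_div_levelSum_sq hrates.min_le hge
        (fun h => (h_eq h).1) fun h => ?_))
    obtain ⟨-, -, υ, -, hυ, hS⟩ := h_lt h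
    exact ⟨υ, hυ, hS⟩
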